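/- Let $\Omega$ be a set and let $k:\Omega\times\Omega\to\mathbb C$ be a positive semidefinite function (a kernel), with reproducing kernel Hilbert space $H^2(k)$: the Hilbert space of functions on $\Omega$ such that $k(\cdot,w)\in H^2(k)$ and $f(w)=\langle f,k(\cdot,w)\rangle$ for all $f\in H^2(k)$, $w\in\Omega$. **Definitions.** * $\mathcal M(k)\subset B(H^2(k))$ is the algebra of multiplication operators $M_\varphi h=\varphi h$ with $\varphi:\Omega\to\mathbb C$ such that $\varphi h\in H^2(k)$ for all $h\in H^2(k)$. * Elements of the Hilbert space tensor product $H^2(k)\otimes E$ ($E$ a Hilbert space) are regarded as $E$-valued functions on $\Omega$. A function $p:\Omega\to B(\ell^2,\mathbb C)$ is a row multiplier if the pointwise product $pF$ lies in $H^2(k)\otimes\mathbb C=H^2(k)$ for every $F\in H^2(k)\otimes\ell^2$. * $k$ is *nice* if $H^2(k)$ is separable and there are row multipliers $p,q$ such that $$1=k(z,w)\,[\,p(z)p(w)^*-q(z)q(w)^*\,]\qquad\text{for all } z,w\in\Omega .$$ * $k$ is a *complete Pick kernel* if for each $\omega\in\Omega$ there is a positive semidefinite function $L_\omega:\Omega\times\Omega\to\mathbb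 C$ such that $$k(y,x)k(\omega,\omega)-k(y,\omega)k(\omega,x)=L_\omega(y,x)\,k(y,x)\qquad\text{for all } x,y\in\Omega .$$ * For a unital subalgebra $\mathcal A\subset B(H)$, let $\mathcal A\,\overline\otimes\,B(\ell^2)$ be the closure in the weak operator topology of $B(H\otimes\ell^2)$ of the set of finite sums $\sum_j A_j\otimes B_j$ with $A_j\in\mathcal A$, $B_j\in B(\ell^2)$. The algebra $\mathcal A$ has the *Douglas property* if for all $A,B\in\mathcal A\,\overline\otimes\,B(\ell^2)$ with $AA^*\succeq BB^*$ there is $C\in\mathcal A\,\overline\otimes\,B(\ell^2)$ with $AC=B$ and $\|C\|\le 1$. **Theorem.** If $k$ is nice and $\mathcal M(k)$ has the Douglas property, then $k$ is a complete Pick kernel. Conversely, if $k$ is a complete Pick kernel with $k(z,w)\neq0$ for all $z,w\in\Omega$, then $\mathcal M(k)$ has the Douglas property. -/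

import Mathlib

open scoped TensorProduct ComplexOrder

namespace DouglasPick

/-- The Hilbert space `ℓ²` of square summable complex sequences. -/
abbrev EllTwo : Type := lp (fun _ : ℕ => ℂ) 2

/-- The Hilbert space tensor product: the completion of the algebraic tensor product, whose inner
product is determined by `⟪h ⊗ e, h' ⊗ e'⟫ = ⟪h, h'⟫ * ⟪e, e'⟫`. -/
abbrev HilbertTensor (H E : Type*) [NormedAddCommGroup H] [InnerProductSpace ℂ H]
    [NormedAddCommGroup E] [InnerProductSpace ℂ E] : Type _ :=
  UniformSpace.Completion (H ⊗[ℂ] E)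

section Operators

variable {H E : Type*} [NormedAddCommGroup H] [InnerProductSpace ℂ H]
  [NormedAddCommGroup E] [InnerProductSpace ℂ E]

/-- The elementary tensor `h ⊗ e` as an element of the Hilbert space tensor product, as a
continuous linear function of `e`. -/
noncomputable def tmulL (E : Type*) [NormedAddCommGroup E] [InnerProductSpace ℂ E] (h : H) :
    E →L[ℂ] HilbertTensor H E :=
  (UniformSpace.Completion.toComplL : (H ⊗[ℂ] E) →L[ℂ] HilbertTensor H E) ∘L
    TensorProduct.mkL ℂ H E h

/-- The bounded operator `A ⊗ B` on the Hilbert space tensor product. -/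
noncomputable def tensorOp (A : H →L[ℂ] H) (B : E →L[ℂ] E) :
    HilbertTensor H E →L[ℂ] HilbertTensor H E :=
  (TensorProduct.mapL A B).completion

theorem tensorOp_tmulL (A : H →L[ℂ] H) (B : E →L[ℂ] E) (h : H) (e : E) :
    tensorOp A B (tmulL E h e) = tmulL E (A h) (B e) := by
  simp [tensorOp, tmulL]

/-- The weak operator topology closure, in the bounded operators on the Hilbert space tensor
product of `H` and `E`, of the algebraic tensor product of `𝒜` and `B(E)`, i.e. of the set of finite
sums of operators `A ⊗ B` with `A ∈ 𝒜` and `B ∈ B(E)`. -/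
def wotTensor (𝒜 : Subalgebra ℂ (H →L[ℂ] H)) (E : Type*) [NormedAddCommGroup E]
    [InnerProductSpace ℂ E] : Set (HilbertTensor H E →L[ℂ] HilbertTensor H E) :=
  {T | ContinuousLinearMapWOT.ofCLM T ∈
    closure (ContinuousLinearMapWOT.ofCLM ''
      (Submodule.span ℂ {S : HilbertTensor H E →L[ℂ] HilbertTensor H E |
        ∃ A ∈ 𝒜, ∃ B : E →L[ℂ] E, S = tensorOp A B} : Set _) :
      Set (HilbertTensor H E →WOT[ℂ] HilbertTensor H E))}

/-- The Douglas property of a (wot-closed) unital algebra `𝒜` of operators on `H`. The order is the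
Loewner order: `S ≤ T` means that `T - S` is a positive semidefinite operator. -/
def DouglasProperty (𝒜 : Subalgebra ℂ (H →L[ℂ] H)) : Prop :=
  ∀ A ∈ wotTensor 𝒜 EllTwo, ∀ B ∈ wotTensor 𝒜 EllTwo,
    B ∘L ContinuousLinearMap.adjoint B ≤ A ∘L ContinuousLinearMap.adjoint A →
      ∃ C ∈ wotTensor 𝒜 EllTwo, A ∘L C = B ∧ ‖C‖ ≤ 1

end Operators

section Kernels

variable {Ω : Type*}

/-- `k` is a positive semidefinite function on `Ω × Ω`. -/
def IsKernel (k : Ω → Ω → ℂ) : Prop := (Matrix.of k).PosSemidef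

/-- `k` is a complete Pick kernel. -/
def IsCompletePick (k : Ω → Ω → ℂ) : Prop :=
  IsKernel k ∧ ∀ ω : Ω, ∃ L : Ω → Ω → ℂ, IsKernel L ∧
    ∀ y x : Ω, k y x * k ω ω - k y ω * k ω x = L y x * k y x

variable (H : Type*) [NormedAddCommGroup H] [InnerProductSpace ℂ H] [RKHS ℂ H Ω ℂ]

/-- The multiplier algebra: the bounded operators on the space `H` of functions on `Ω` that are of
the form `M_φ h = φ h` for a function `φ` on `Ω`. -/
def multiplierAlgebra : Subalgebra ℂ (H →L[ℂ] H) where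
  carrier := {T | ∃ φ : Ω → ℂ, ∀ (h : H) (z : Ω), (T h) z = φ z * h z}
  mul_mem' := by
    rintro S T ⟨φ, hφ⟩ ⟨ψ, hψ⟩
    exact ⟨φ * ψ, fun h z => by simp [hφ, hψ, mul_assoc]⟩
  add_mem' := by
    rintro S T ⟨φ, hφ⟩ ⟨ψ, hψ⟩
    exact ⟨φ + ψ, fun h z => by simp [hφ, hψ, add_mul]⟩
  algebraMap_mem' c := ⟨fun _ => c, fun h z => by simp [Algebra.algebraMap_eq_smul_one]⟩

variable [CompleteSpace H]

/-- `H` is the space `H²(k)`: the Hilbert space of functions on `Ω` in which `k(·, w)` is the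
function that reproduces the value at `w`. -/
def IsSpaceOfKernel (k : Ω → Ω → ℂ) : Prop :=
  ∀ w z : Ω, RKHS.kerFun H w 1 z = k z w

/-- The value at `z` of an element `F` of `H ⊗ E`, viewed as an `E`-valued function on `Ω`; it is
characterized by `⟪e, F(z)⟫ = ⟪k(·, z) ⊗ e, F⟫`. -/
noncomputable def evalTensor (E : Type*) [NormedAddCommGroup E] [InnerProductSpace ℂ E]
    [CompleteSpace E] (z : Ω) : HilbertTensor H E →L[ℂ] E :=
  ContinuousLinearMap.adjoint (tmulL E (RKHS.kerFun H z 1))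

theorem evalTensor_tmulL (E : Type*) [NormedAddCommGroup E] [InnerProductSpace ℂ E]
    [CompleteSpace E] (z : Ω) (h : H) (e : E) :
    evalTensor H E z (tmulL E h e) = h z • e := by
  refine ext_inner_left ℂ fun v => ?_
  rw [evalTensor, ContinuousLinearMap.adjoint_inner_right]
  simp [tmulL, inner_smul_right]

/-- `Φ : Ω → B(E, F)` is a multiplier: the pointwise product of `Φ` with any function in `H ⊗ E`
is a function in `H ⊗ F`. -/
def IsMultiplier {E F : Type*} [NormedAddCommGroup E] [InnerProductSpace ℂ E] [CompleteSpace E]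
    [NormedAddCommGroup F] [InnerProductSpace ℂ F] [CompleteSpace F] (Φ : Ω → E →L[ℂ] F) : Prop :=
  ∀ f : HilbertTensor H E, ∃ g : HilbertTensor H F,
    ∀ z : Ω, evalTensor H F z g = Φ z (evalTensor H E z f)

/-- The kernel `k` of the space `H` is nice: `H` is separable and
`1 = k(z, w) [p(z) p(w)^* - q(z) q(w)^*]` for some row multipliers `p`, `q`. -/
def IsNice (k : Ω → Ω → ℂ) : Prop :=
  TopologicalSpace.SeparableSpace H ∧
    ∃ p q : Ω → EllTwo →L[ℂ] ℂ, IsMultiplier H p ∧ IsMultiplier H q ∧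
      ∀ z w : Ω, (1 : ℂ →L[ℂ] ℂ) =
        k z w • (p z ∘L ContinuousLinearMap.adjoint (p w)
          - q z ∘L ContinuousLinearMap.adjoint (q w))

end Kernels

end DouglasPick

open scoped TensorProduct ComplexOrder

namespace DouglasPick

open scoped InnerProductSpace
open Filter Topology

/-! ### Gram matrices and contractions. -/

section Gram

variable {ι X Y : Type*} [NormedAddCommGroup X] [InnerProductSpace ℂ X]
  [NormedAddCommGroup Y] [InnerProductSpace ℂ Y]

/-! Both directions reduce to functions on `Ω`: when `k` has nonzero diagonal, the operators in
`wotTensor (multiplierAlgebra H) EllTwo` are exactly those that multiply by an operator-valued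
symbol (`exists_hasSymbol_of_mem_wotTensor`, `HasSymbol.mem_wotTensor`). The adjoint of such an
operator sends `k_w ⊗ e` to `k_w ⊗ Φ(w)* e`, so operator inequalities become positivity of Gram
matrices.

Necessity. Put `P w = p(w)* 1` and `Q w = q(w)* 1`. Niceness says that `TT*` for the row `p` minus
`TT*` for the row `q` is a positive rank-one kernel, so the Douglas property gives a contractive `C`
with symbol `Γ` and `C* (k_w ⊗ P w) = k_w ⊗ Q w`. On the differences `k_w ⊗ P w - k_ω ⊗ P ω` the
contraction `C*` is isometric, hence `CC*` fixes them. Evaluating at `ω` shows that the contraction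
`Γ ω` maps `k(ω,w) Q w - k(ω,ω) Q ω` to the same expression in `P`. The defect of `Γ ω` on these
vectors is a positive kernel, and it equals `k(ω,ω) - k(z,ω) k(ω,w) / k(z,w)`.

Sufficiency. The Pick condition at a base point factors `k(z,w) (1 - ⟪β z, β w⟫)` as `conj (γ z) * γ
w`. A lurking isometry argument then proves Leech's theorem (`exists_contractive_multiplier`), with
the solution given by the transfer function of a contraction (`exists_transferFunction`). -/

theorem sum_star_mul_inner_mul (a b : ι → X) (x : ι →₀ ℂ) :
    (x.sum fun i xi => x.sum fun j xj => star xi * ⟪a i, b j⟫_ℂ * xj) =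
      ⟪Finsupp.linearCombination ℂ a x, Finsupp.linearCombination ℂ b x⟫_ℂ := by
  simp only [Finsupp.linearCombination_apply, Finsupp.sum, sum_inner, inner_smul_left]
  simp only [inner_sum, inner_smul_right, Finset.mul_sum, starRingEnd_apply]
  refine Finset.sum_congr rfl fun i _ => Finset.sum_congr rfl fun j _ => ?_
  ring

/-- The quadratic form is continuous, so it suffices to check its sign on the dense span of the
family. -/
theorem isPositive_of_posSemidef [CompleteSpace X] (T : X →L[ℂ] X) (v : ι → X)
    (hv : (Submodule.span ℂ (Set.range v)).topologicalClosure = ⊤)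
    (h : (Matrix.of fun i j => ⟪v i, T (v j)⟫_ℂ).PosSemidef) : T.IsPositive := by
  have key : ∀ x, 0 ≤ ⟪x, T x⟫_ℂ := by
    have hc : IsClosed {x : X | 0 ≤ ⟪x, T x⟫_ℂ} :=
      isClosed_le continuous_const (by fun_prop)
    have hs : ((Submodule.span ℂ (Set.range v) : Submodule ℂ X) : Set X) ⊆
        {x : X | 0 ≤ ⟪x, T x⟫_ℂ} := by
      intro x hx
      obtain ⟨c, rfl⟩ := (Finsupp.mem_span_range_iff_exists_finsupp).1 hx
      have := h.2 c
      simp only [Matrix.of_apply] at this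
      rw [sum_star_mul_inner_mul v (fun j => T (v j)) c] at this
      simpa [Finsupp.linearCombination_apply, map_finsuppSum] using this
    intro x
    have hx : x ∈ (Submodule.span ℂ (Set.range v)).topologicalClosure := by rw [hv]; trivial
    exact closure_minimal hs hc hx
  rw [ContinuousLinearMap.isPositive_iff_complex]
  intro x
  have h1 := key x
  have h2 : ⟪T x, x⟫_ℂ = ⟪x, T x⟫_ℂ := by
    rw [← inner_conj_symm]
    exact Complex.conj_eq_iff_im.2 (Complex.le_def.1 h1).2.symm
  rw [h2]
  exact ⟨(Complex.conj_eq_iff_re.1 (Complex.conj_eq_iff_im.2 (Complex.le_def.1 h1).2.symm)),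
    (Complex.le_def.1 h1).1⟩

/-- A family of vectors whose Gram matrix is dominated by that of another family is the image of
the latter under a contraction. -/
theorem exists_contraction_of_gram_le [CompleteSpace X] [CompleteSpace Y] (a : ι → X) (b : ι → Y)
    (h : (Matrix.gram ℂ a - Matrix.gram ℂ b).PosSemidef) :
    ∃ V : X →L[ℂ] Y, ‖V‖ ≤ 1 ∧ ∀ i, V (a i) = b i := by
  have hle : ∀ x : ι →₀ ℂ, ‖Finsupp.linearCombination ℂ b x‖ ≤
      1 * ‖Finsupp.linearCombination ℂ a x‖ := by
    intro x
    have := h.2 x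
    simp only [Matrix.sub_apply, Matrix.gram_apply, mul_sub, sub_mul, Finsupp.sum_sub] at this
    rw [sum_star_mul_inner_mul, sum_star_mul_inner_mul, inner_self_eq_norm_sq_to_K,
      inner_self_eq_norm_sq_to_K, sub_nonneg] at this
    have h2 : ‖Finsupp.linearCombination ℂ b x‖ ^ 2 ≤ ‖Finsupp.linearCombination ℂ a x‖ ^ 2 := by
      exact_mod_cast this
    rw [one_mul]
    exact le_of_sq_le_sq h2 (norm_nonneg _)
  set S : Submodule ℂ X := (LinearMap.range (Finsupp.linearCombination ℂ a)).topologicalClosure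
    with hS
  have : CompleteSpace S :=
    (Submodule.isClosed_topologicalClosure _).completeSpace_coe
  let e : (ι →₀ ℂ) →ₗ[ℂ] S := (Finsupp.linearCombination ℂ a).codRestrict S
    fun x => Submodule.le_topologicalClosure _ ⟨x, rfl⟩
  have hd : DenseRange e := by
    intro y
    rw [closure_subtype]
    have : Subtype.val '' Set.range e =
        (LinearMap.range (Finsupp.linearCombination ℂ a) : Set X) := by
      ext z
      simp [e, ← Set.range_comp, Function.comp_def]
    rw [this]
    exact y.2
  -- The map is extended by continuity to the closed span of the `a i`, and by zero on the
  -- orthogonal complement.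
  let W : S →L[ℂ] Y := (Finsupp.linearCombination ℂ b).extendOfNorm e
  refine ⟨W ∘L S.orthogonalProjectionOnto, ?_, fun i => ?_⟩
  · have h1 : ‖W‖ ≤ 1 := LinearMap.opNorm_extendOfNorm_le hd zero_le_one hle
    calc _ ≤ ‖W‖ * ‖S.orthogonalProjectionOnto‖ := ContinuousLinearMap.opNorm_comp_le _ _
      _ ≤ 1 * 1 := by
        gcongr
        exact Submodule.orthogonalProjectionOnto_norm_le S
      _ = 1 := one_mul 1
  · have h1 : (S.orthogonalProjectionOnto (a i) : S) = e (Finsupp.single i 1) := by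
      have : a i = (e (Finsupp.single i 1) : X) := by simp [e]
      rw [this, Submodule.orthogonalProjectionOnto_mem_subspace_eq_self]
    have h2 := LinearMap.extendOfNorm_eq (f := Finsupp.linearCombination ℂ b) hd ⟨1, hle⟩
      (Finsupp.single i 1)
    simp [h1, W, h2]

theorem posSemidef_gramFamily (v : ι → X) : (Matrix.gram ℂ v).PosSemidef := by
  refine ⟨Matrix.isHermitian_gram ℂ v, fun x => ?_⟩
  simp only [Matrix.gram_apply]
  rw [sum_star_mul_inner_mul v v x, inner_self_eq_norm_sq_to_K]
  positivity

theorem posSemidef_gram_sub_gram {V : X →L[ℂ] Y} (hV : ‖V‖ ≤ 1) (a : ι → X) :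
    (Matrix.gram ℂ a - Matrix.gram ℂ fun i => V (a i)).PosSemidef := by
  refine ⟨(Matrix.isHermitian_gram ℂ _).sub (Matrix.isHermitian_gram ℂ _), fun x => ?_⟩
  have h : Finsupp.linearCombination ℂ (fun i => V (a i)) x =
      V (Finsupp.linearCombination ℂ a x) := by
    simp [Finsupp.linearCombination_apply, map_finsuppSum]
  simp only [Matrix.sub_apply, Matrix.gram_apply, mul_sub, sub_mul, Finsupp.sum_sub]
  rw [sum_star_mul_inner_mul, sum_star_mul_inner_mul, inner_self_eq_norm_sq_to_K,
    inner_self_eq_norm_sq_to_K, sub_nonneg, h]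
  have h1 : ‖V (Finsupp.linearCombination ℂ a x)‖ ≤ ‖Finsupp.linearCombination ℂ a x‖ := by
    simpa using V.le_of_opNorm_le hV (Finsupp.linearCombination ℂ a x)
  have h2 : ‖V (Finsupp.linearCombination ℂ a x)‖ ^ 2 ≤ ‖Finsupp.linearCombination ℂ a x‖ ^ 2 := by
    gcongr
  exact_mod_cast h2

/-- A vector on which the adjoint of a contraction is isometric is fixed by `C C^*`. -/
theorem apply_adjoint_eq_self [CompleteSpace X] {C : X →L[ℂ] X} (hC : ‖C‖ ≤ 1) {v : X}
    (h : ⟪v, v⟫_ℂ = ⟪C.adjoint v, C.adjoint v⟫_ℂ) : C (C.adjoint v) = v := by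
  have h1 : ‖C (C.adjoint v)‖ ≤ ‖C.adjoint v‖ := by
    simpa using C.le_of_opNorm_le hC (C.adjoint v)
  have h2 : ‖v‖ ^ 2 = ‖C.adjoint v‖ ^ 2 := by
    rw [inner_self_eq_norm_sq_to_K, inner_self_eq_norm_sq_to_K] at h
    exact_mod_cast h
  -- The square expands to `‖CC*v‖² - 2‖C*v‖² + ‖v‖²`, where `‖v‖ = ‖C*v‖` and `‖CC*v‖ ≤ ‖C*v‖`.
  have h3 : ‖C (C.adjoint v) - v‖ ^ 2 ≤ 0 := by
    rw [@norm_sub_sq ℂ, ← ContinuousLinearMap.adjoint_inner_right, inner_self_eq_norm_sq, h2]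
    have : ‖C (C.adjoint v)‖ ^ 2 ≤ ‖C.adjoint v‖ ^ 2 := by gcongr
    linarith
  exact sub_eq_zero.1 (norm_eq_zero.1 (pow_eq_zero_iff two_ne_zero |>.1
    (le_antisymm h3 (sq_nonneg _))))

/-- Every positive semidefinite function is the Gram function of a family of vectors. -/
theorem exists_gram_eq.{u} {Ω : Type u} {L : Ω → Ω → ℂ} (hL : IsKernel L) :
    ∃ (K : Type u) (_ : NormedAddCommGroup K) (_ : InnerProductSpace ℂ K) (_ : CompleteSpace K)
      (β : Ω → K), ∀ y x, ⟪β y, β x⟫_ℂ = L y x := by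
  -- Scalars are read as operators on `ℂ`, and `β` is the family of kernel functions of the
  -- resulting space.
  let M : Matrix Ω Ω (ℂ →L[ℂ] ℂ) := Matrix.of fun y x => L y x • (1 : ℂ →L[ℂ] ℂ)
  have hM : M.PosSemidef := by
    refine ((RKHS.posSemidef_tfae (K := M)).out 0 2 rfl rfl).2 ⟨?_, fun v => ?_⟩
    · ext y x
      have := hL.1.apply y x
      simp only [Matrix.of_apply] at this
      simp [M, ← this]
    · have h1 : (v.sum fun x w => v.sum fun x' w' => ⟪M x' x w, w'⟫_ℂ) =
          v.sum fun x w => v.sum fun x' w' => star w * Matrix.of L x x' * w' := by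
        refine Finset.sum_congr rfl fun x _ => Finset.sum_congr rfl fun x' _ => ?_
        have h2 := hL.1.apply x x'
        simp only [Matrix.of_apply] at h2
        simp [M, ← h2]
        ring
      rw [h1]
      exact (Complex.le_def.1 (hL.2 v)).1
  have : Fact M.PosSemidef := ⟨hM⟩
  refine ⟨RKHS.OfKernel M, inferInstance, inferInstance, inferInstance,
    fun y => RKHS.kerFun (RKHS.OfKernel M) y 1, fun y x => ?_⟩
  rw [← RKHS.kernel_inner, RKHS.OfKernel.kernel_ofKernel]
  have := hL.1.apply y x
  simp only [Matrix.of_apply] at this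
  simp [M, ← this]

end Gram

/-! ### Hilbert space tensor products and ampliations. -/

section Tensor

variable {H E F : Type*} [NormedAddCommGroup H] [InnerProductSpace ℂ H]
  [NormedAddCommGroup E] [InnerProductSpace ℂ E] [NormedAddCommGroup F] [InnerProductSpace ℂ F]

theorem inner_tmulL (h h' : H) (e e' : E) :
    ⟪tmulL E h e, tmulL E h' e'⟫_ℂ = ⟪h, h'⟫_ℂ * ⟪e, e'⟫_ℂ := by
  simp [tmulL]

theorem norm_tmulL (h : H) (e : E) : ‖tmulL E h e‖ = ‖h‖ * ‖e‖ := by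
  simp [tmulL]

/-- The elementary tensor `h ⊗ e` as a continuous linear function of `h`. -/
noncomputable def tmulR (H : Type*) [NormedAddCommGroup H] [InnerProductSpace ℂ H] (e : E) :
    H →L[ℂ] HilbertTensor H E :=
  (UniformSpace.Completion.toComplL : (H ⊗[ℂ] E) →L[ℂ] HilbertTensor H E) ∘L
    (TensorProduct.mkL ℂ H E).flip e

theorem tmulR_apply (h : H) (e : E) : tmulR H e h = tmulL E h e := rfl

theorem ext_tmulL {X : Type*} [NormedAddCommGroup X] [NormedSpace ℂ X]
    {S T : HilbertTensor H E →L[ℂ] X} (h : ∀ x e, S (tmulL E x e) = T (tmulL E x e)) : S = T := by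
  ext x
  induction x using UniformSpace.Completion.induction_on with
  | hp => exact isClosed_eq S.continuous T.continuous
  | ih a =>
    induction a using TensorProduct.induction_on with
    | zero => rw [UniformSpace.Completion.coe_zero, map_zero, map_zero]
    | tmul x e => simpa [tmulL] using h x e
    | add x y hx hy => simp [UniformSpace.Completion.coe_add, hx, hy]

theorem eq_zero_of_inner_tmulL {x : HilbertTensor H E} (h : ∀ y e, ⟪x, tmulL E y e⟫_ℂ = 0) :
    x = 0 := by
  have h1 : innerSL ℂ x = 0 := ext_tmulL (by simpa using h)
  have h2 := congr($h1 x)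
  simpa using h2

/-- The operator `1 ⊗ S` between Hilbert space tensor products. -/
noncomputable def ampliation (H : Type*) [NormedAddCommGroup H] [InnerProductSpace ℂ H]
    (S : E →L[ℂ] F) : HilbertTensor H E →L[ℂ] HilbertTensor H F :=
  (TensorProduct.mapL (ContinuousLinearMap.id ℂ H) S).completion

theorem ampliation_tmulL (S : E →L[ℂ] F) (h : H) (e : E) :
    ampliation H S (tmulL E h e) = tmulL F h (S e) := by
  simp [ampliation, tmulL]

theorem norm_ampliation_le (S : E →L[ℂ] F) : ‖ampliation H S‖ ≤ ‖S‖ := by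
  refine ContinuousLinearMap.opNorm_le_bound _ (norm_nonneg _) fun x => ?_
  induction x using UniformSpace.Completion.induction_on with
  | hp => exact isClosed_le (by fun_prop) (by fun_prop)
  | ih a =>
    have h1 : ‖TensorProduct.mapL (ContinuousLinearMap.id ℂ H) S‖ ≤ ‖S‖ := by
      refine (TensorProduct.norm_mapL_le _ _).trans ?_
      exact mul_le_of_le_one_left (norm_nonneg _) ContinuousLinearMap.norm_id_le
    have h2 := (TensorProduct.mapL (ContinuousLinearMap.id ℂ H) S).le_of_opNorm_le h1 a
    simpa [ampliation] using h2

theorem ampliation_finset_sum {ι : Type*} (s : Finset ι) (S : ι → E →L[ℂ] F) :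
    ampliation H (∑ i ∈ s, S i) = ∑ i ∈ s, ampliation H (S i) := by
  refine ext_tmulL fun x e => ?_
  simp [ampliation_tmulL]

/-- Strong convergence of a bounded net of operators is inherited by ampliations. -/
theorem tendsto_ampliation {ι : Type*} {l : Filter ι} {P : ι → E →L[ℂ] E}
    (hP : ∀ i, ‖P i‖ ≤ 1) (h : ∀ e, Tendsto (fun i => P i e) l (𝓝 e)) (x : HilbertTensor H E) :
    Tendsto (fun i => ampliation H (P i) x) l (𝓝 x) := by
  have hP' : ∀ i y, ‖ampliation H (P i) y‖ ≤ ‖y‖ := fun i y => by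
    simpa using (ampliation H (P i)).le_of_opNorm_le ((norm_ampliation_le _).trans (hP i)) y
  have hd : ∀ a : H ⊗[ℂ] E, Tendsto (fun i => ampliation H (P i) (a : HilbertTensor H E)) l
      (𝓝 (a : HilbertTensor H E)) := by
    intro a
    induction a using TensorProduct.induction_on with
    | zero =>
      rw [UniformSpace.Completion.coe_zero]
      simp only [map_zero, tendsto_const_nhds]
    | tmul x e =>
      have h1 : ((x ⊗ₜ[ℂ] e : H ⊗[ℂ] E) : HilbertTensor H E) = tmulL E x e := by simp [tmulL]
      simp only [h1, ampliation_tmulL]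
      exact ((tmulL E x).continuous.tendsto e).comp (h e)
    | add x y hx hy =>
      simp only [UniformSpace.Completion.coe_add, map_add]
      exact hx.add hy
  rw [Metric.tendsto_nhds]
  intro ε hε
  obtain ⟨a, ha⟩ := UniformSpace.Completion.denseRange_coe.exists_dist_lt x
    (show 0 < ε / 3 by positivity)
  filter_upwards [(Metric.tendsto_nhds.1 (hd a)) (ε / 3) (by positivity)] with i hi
  have h1 : dist (ampliation H (P i) x) (ampliation H (P i) (a : HilbertTensor H E)) < ε / 3 := by
    rw [dist_eq_norm, ← map_sub]
    refine (hP' i _).trans_lt ?_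
    rwa [← dist_eq_norm]
  rw [dist_comm] at ha
  calc _ ≤ dist (ampliation H (P i) x) (ampliation H (P i) (a : HilbertTensor H E)) +
        dist (ampliation H (P i) (a : HilbertTensor H E)) a + dist (a : HilbertTensor H E) x :=
        dist_triangle4 _ _ _ _
    _ < ε / 3 + ε / 3 + ε / 3 := by gcongr
    _ = ε := by ring

end Tensor

/-! ### Point evaluations and operator-valued symbols. -/

section Eval

variable {Ω H E F : Type*} [NormedAddCommGroup H] [InnerProductSpace ℂ H] [CompleteSpace H]
  [RKHS ℂ H Ω ℂ]
  [NormedAddCommGroup E] [InnerProductSpace ℂ E] [CompleteSpace E]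
  [NormedAddCommGroup F] [InnerProductSpace ℂ F] [CompleteSpace F]

theorem inner_tmulL_kerFun (w : Ω) (e : E) (x : HilbertTensor H E) :
    ⟪tmulL E (RKHS.kerFun H w 1) e, x⟫_ℂ = ⟪e, evalTensor H E w x⟫_ℂ :=
  (ContinuousLinearMap.adjoint_inner_right _ _ _).symm

/-- Slicing `x` against `e` gives an element of `H` whose value at `z` is `⟪e, x(z)⟫`, so every
slice is zero and `x` is orthogonal to all elementary tensors. -/
theorem eq_zero_of_evalTensor {x : HilbertTensor H E} (h : ∀ w : Ω, evalTensor H E w x = 0) :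
    x = 0 := by
  refine eq_zero_of_inner_tmulL fun y e => ?_
  rw [← tmulR_apply, ← ContinuousLinearMap.adjoint_inner_left]
  suffices (tmulR H e).adjoint x = 0 by simp [this]
  ext z
  have h1 := RKHS.kerFun_inner (𝕜 := ℂ) z (1 : ℂ) ((tmulR H e).adjoint x)
  rw [ContinuousLinearMap.adjoint_inner_right, tmulR_apply, inner_tmulL_kerFun, h z] at h1
  simpa using h1.symm

theorem ext_evalTensor {x y : HilbertTensor H E}
    (h : ∀ w : Ω, evalTensor H E w x = evalTensor H E w y) : x = y :=
  sub_eq_zero.1 (eq_zero_of_evalTensor fun w : Ω => by rw [map_sub, h, sub_self])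

theorem span_tmulL_kerFun : (Submodule.span ℂ (Set.range fun p : Ω × E =>
    tmulL E (RKHS.kerFun H p.1 1) p.2)).topologicalClosure = ⊤ := by
  refine Submodule.orthogonal_eq_bot_iff.1 ((Submodule.eq_bot_iff _).2 fun x hx => ?_)
  rw [Submodule.orthogonal_closure] at hx
  refine eq_zero_of_evalTensor fun w : Ω => ext_inner_left ℂ fun e => ?_
  rw [← inner_tmulL_kerFun, inner_zero_right]
  exact hx _ (Submodule.subset_span ⟨(w, e), rfl⟩)

theorem evalTensor_tmulL_kerFun (z w : Ω) (e : E) :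
    evalTensor H E z (tmulL E (RKHS.kerFun H w 1) e) = RKHS.kerFun H w 1 z • e :=
  evalTensor_tmulL H E z _ e

theorem evalTensor_ampliation (S : E →L[ℂ] F) (z : Ω) (x : HilbertTensor H E) :
    evalTensor H F z (ampliation H S x) = S (evalTensor H E z x) := by
  have : evalTensor H F z ∘L ampliation H S = S ∘L evalTensor H E z :=
    ext_tmulL fun h e => by simp [ampliation_tmulL, evalTensor_tmulL]
  exact congr($this x)

theorem evalTensor_tensorOp {A : H →L[ℂ] H} {φ : Ω → ℂ} (hA : ∀ (h : H) z, A h z = φ z * h z)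
    (B : E →L[ℂ] E) (z : Ω) (x : HilbertTensor H E) :
    evalTensor H E z (tensorOp A B x) = φ z • B (evalTensor H E z x) := by
  have : evalTensor H E z ∘L tensorOp A B = φ z • B ∘L evalTensor H E z :=
    ext_tmulL fun h e => by simp [tensorOp_tmulL, evalTensor_tmulL, hA, mul_smul]
  exact congr($this x)

/-- The operator `T` on `H ⊗ E` is multiplication by the operator valued function `Φ`. -/
def HasSymbol (T : HilbertTensor H E →L[ℂ] HilbertTensor H F) (Φ : Ω → E →L[ℂ] F) : Prop :=
  ∀ z x, evalTensor H F z (T x) = Φ z (evalTensor H E z x)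

theorem HasSymbol.adjoint_tmulL {T : HilbertTensor H E →L[ℂ] HilbertTensor H F}
    {Φ : Ω → E →L[ℂ] F} (hT : HasSymbol T Φ) (w : Ω) (e : F) :
    T.adjoint (tmulL F (RKHS.kerFun H w 1) e) =
      tmulL E (RKHS.kerFun H w 1) ((Φ w).adjoint e) := by
  refine ext_inner_right ℂ fun x => ?_
  rw [ContinuousLinearMap.adjoint_inner_left, inner_tmulL_kerFun, inner_tmulL_kerFun, hT,
    ContinuousLinearMap.adjoint_inner_left]

/-- Preserving the functions that vanish at `w` is a condition closed in the weak operator topology,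
and it holds for the generators `A ⊗ B`. Hence `(T x)(w)` depends only on `x(w)`. -/
theorem exists_hasSymbol_of_mem_wotTensor (hk : ∀ w : Ω, RKHS.kerFun H w (1 : ℂ) w ≠ 0)
    {T : HilbertTensor H E →L[ℂ] HilbertTensor H E} (hT : T ∈ wotTensor (multiplierAlgebra H) E) :
    ∃ Φ : Ω → E →L[ℂ] E, HasSymbol T Φ := by
  have key : ∀ (w : Ω) x, evalTensor H E w x = 0 → evalTensor H E w (T x) = 0 := by
    intro w x hx
    refine ext_inner_left ℂ fun e => ?_
    rw [inner_zero_right, ← inner_tmulL_kerFun]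
    let y : StrongDual ℂ (HilbertTensor H E) := innerSL ℂ (tmulL E (RKHS.kerFun H w 1) e)
    have hc : IsClosed {S : HilbertTensor H E →WOT[ℂ] HilbertTensor H E | y (S x) = 0} :=
      isClosed_eq (ContinuousLinearMapWOT.continuous_dual_apply x y) continuous_const
    have := closure_minimal ?_ hc hT
    · exact this
    rintro _ ⟨S, hS, rfl⟩
    have h0 : evalTensor H E w (S x) = 0 := by
      induction hS using Submodule.span_induction with
      | mem S hS =>
        obtain ⟨A, ⟨φ, hφ⟩, B, rfl⟩ := hS
        rw [evalTensor_tensorOp hφ, hx, map_zero, smul_zero]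
      | zero => simp
      | add S S' _ _ h h' => simp [h, h']
      | smul c S _ h => simp [h]
    show ⟪_, S x⟫_ℂ = 0
    rw [inner_tmulL_kerFun, h0, inner_zero_right]
  -- The function `k(w,w)⁻¹ k_w ⊗ x(w)` has the same value at `w` as `x`.
  refine ⟨fun w => (RKHS.kerFun H w (1 : ℂ) w)⁻¹ •
    (evalTensor H E w ∘L T ∘L tmulL E (RKHS.kerFun H w 1)), fun w x => ?_⟩
  have h1 := key w (x - (RKHS.kerFun H w (1 : ℂ) w)⁻¹ •
    tmulL E (RKHS.kerFun H w 1) (evalTensor H E w x)) (by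
      rw [map_sub, map_smul, evalTensor_tmulL_kerFun, smul_smul, inv_mul_cancel₀ (hk w), one_smul,
        sub_self])
  rw [map_sub, map_sub, map_smul, map_smul, sub_eq_zero] at h1
  simpa using h1

end Eval

/-! ### Truncation in `ℓ²` and membership in the closure. -/

section EllTwo

variable {Ω H : Type*} [NormedAddCommGroup H] [InnerProductSpace ℂ H] [CompleteSpace H]
  [RKHS ℂ H Ω ℂ]

/-- The standard basis vectors of `ℓ²`. -/
noncomputable def basisVec (i : ℕ) : EllTwo := lp.single 2 i 1

theorem inner_basisVec (i : ℕ) (x : EllTwo) : ⟪basisVec i, x⟫_ℂ = x i := by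
  simp [basisVec, lp.inner_single_left]

/-- The coordinate projections of `ℓ²`. -/
noncomputable def coordProj (i : ℕ) : EllTwo →L[ℂ] EllTwo :=
  (innerSL ℂ (basisVec i)).smulRight (basisVec i)

theorem coordProj_apply (i : ℕ) (x : EllTwo) : coordProj i x = lp.single 2 i (x i) := by
  rw [coordProj, ContinuousLinearMap.smulRight_apply, innerSL_apply_apply, inner_basisVec,
    basisVec, ← lp.single_smul]
  simp

theorem norm_sum_coordProj_le (s : Finset ℕ) : ‖∑ i ∈ s, coordProj i‖ ≤ 1 := by
  refine ContinuousLinearMap.opNorm_le_bound _ zero_le_one fun x => ?_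
  have h2 : 0 < (2 : ENNReal).toReal := by norm_num
  have h1 := lp.norm_sum_single h2 (fun i => x i) s
  have h3 := lp.sum_rpow_le_norm_rpow h2 x s
  rw [← h1] at h3
  rw [one_mul, sum_apply]
  simp only [coordProj_apply]
  exact (Real.rpow_le_rpow_iff (norm_nonneg _) (norm_nonneg _) h2).1 h3

theorem tendsto_sum_coordProj (x : EllTwo) :
    Tendsto (fun s : Finset ℕ => (∑ i ∈ s, coordProj i) x) atTop (𝓝 x) := by
  have := lp.hasSum_single (p := 2) (by norm_num) x
  simpa [HasSum, sum_apply, coordProj_apply] using this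

/-- Compressing `T` to finitely many coordinates of `ℓ²` gives a finite matrix of scalar
multipliers, and these compressions converge strongly to `T`. -/
theorem HasSymbol.mem_wotTensor {T : HilbertTensor H EllTwo →L[ℂ] HilbertTensor H EllTwo}
    {Φ : Ω → EllTwo →L[ℂ] EllTwo} (hT : HasSymbol T Φ) :
    T ∈ wotTensor (multiplierAlgebra H) EllTwo := by
  let P : Finset ℕ → HilbertTensor H EllTwo →L[ℂ] HilbertTensor H EllTwo :=
    fun s => ampliation H (∑ i ∈ s, coordProj i)
  have hP : ∀ x, Tendsto (fun s => P s x) atTop (𝓝 x) :=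
    tendsto_ampliation norm_sum_coordProj_le tendsto_sum_coordProj
  have hmem : ∀ s, P s ∘L T ∘L P s ∈
      Submodule.span ℂ {S : HilbertTensor H EllTwo →L[ℂ] HilbertTensor H EllTwo |
        ∃ A ∈ multiplierAlgebra H, ∃ B : EllTwo →L[ℂ] EllTwo, S = tensorOp A B} := by
    intro s
    have h1 : P s ∘L T ∘L P s = ∑ i ∈ s, ∑ j ∈ s,
        ampliation H (coordProj i) ∘L T ∘L ampliation H (coordProj j) := by
      ext1 x
      simp [P, ampliation_finset_sum]
      rw [Finset.sum_comm]
    rw [h1]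
    refine Submodule.sum_mem _ fun i _ => Submodule.sum_mem _ fun j _ =>
      Submodule.subset_span ?_
    -- The `(i, j)` matrix entry of `T` multiplies by the corresponding entry of `Φ`.
    have h2 : ∀ (h : H) (z : Ω),
        ((tmulR H (basisVec i)).adjoint ∘L T ∘L tmulR H (basisVec j)) h z =
          ⟪basisVec i, Φ z (basisVec j)⟫_ℂ * h z := by
      intro h z
      have h3 := RKHS.kerFun_inner (𝕜 := ℂ) z (1 : ℂ)
        (((tmulR H (basisVec i)).adjoint ∘L T ∘L tmulR H (basisVec j)) h)
      rw [ContinuousLinearMap.comp_apply, ContinuousLinearMap.adjoint_inner_right, tmulR_apply,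
        inner_tmulL_kerFun, ContinuousLinearMap.comp_apply, hT, tmulR_apply, evalTensor_tmulL,
        map_smul, inner_smul_right] at h3
      rw [mul_comm, h3]
      simp [tmulR_apply]
    refine ⟨_, ⟨_, h2⟩, (innerSL ℂ (basisVec j)).smulRight (basisVec i), ?_⟩
    ext1 x
    refine ext_evalTensor fun z : Ω => ?_
    rw [evalTensor_tensorOp h2]
    simp only [ContinuousLinearMap.comp_apply, evalTensor_ampliation, hT z]
    simp [coordProj, smul_smul, mul_comm]
  refine mem_closure_of_tendsto (f := fun s => ContinuousLinearMapWOT.ofCLM (P s ∘L T ∘L P s))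
    (b := atTop) ?_ (Eventually.of_forall fun s => ⟨_, hmem s, rfl⟩)
  rw [ContinuousLinearMapWOT.tendsto_iff_forall_dual_apply_tendsto]
  intro x y
  refine (y.continuous.tendsto _).comp ?_
  -- The uniform bound on `P s` controls the first summand.
  have h4 : Tendsto (fun s => P s (T (P s x - x)) + P s (T x)) atTop (𝓝 (0 + T x)) := by
    refine Tendsto.add ?_ (hP (T x))
    refine squeeze_zero_norm (a := fun s => ‖T (P s x - x)‖) (fun s => ?_) ?_
    · simpa using (P s).le_of_opNorm_le
        ((norm_ampliation_le _).trans (norm_sum_coordProj_le s)) (T (P s x - x))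
    · have h5 : Tendsto (fun s => P s x - x) atTop (𝓝 0) := by
        simpa using (hP x).sub_const x
      simpa using ((T.continuous.tendsto 0).comp h5).norm
  simpa using h4

end EllTwo

/-! ### Boundedness and kernel identities for multipliers. -/

section Multiplier

variable {Ω H E F : Type*} [NormedAddCommGroup H] [InnerProductSpace ℂ H] [CompleteSpace H]
  [RKHS ℂ H Ω ℂ]
  [NormedAddCommGroup E] [InnerProductSpace ℂ E] [CompleteSpace E]
  [NormedAddCommGroup F] [InnerProductSpace ℂ F] [CompleteSpace F]

theorem IsSpaceOfKernel.inner_kerFun {k : Ω → Ω → ℂ} (hk : IsSpaceOfKernel H k) (z w : Ω) :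
    ⟪RKHS.kerFun H z (1 : ℂ), RKHS.kerFun H w (1 : ℂ)⟫_ℂ = k z w := by
  rw [RKHS.kerFun_inner, hk]
  simp

theorem IsSpaceOfKernel.isKernel {k : Ω → Ω → ℂ} (hk : IsSpaceOfKernel H k) : IsKernel k := by
  have : Matrix.of k = Matrix.gram ℂ fun w : Ω => RKHS.kerFun H w (1 : ℂ) := by
    ext z w
    rw [Matrix.gram_apply, hk.inner_kerFun, Matrix.of_apply]
  rw [IsKernel, this]
  exact posSemidef_gramFamily _

/-- Multiplication by a multiplier is bounded, by the closed graph theorem. -/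
theorem IsMultiplier.exists_hasSymbol {Φ : Ω → E →L[ℂ] F} (hΦ : IsMultiplier H Φ) :
    ∃ T : HilbertTensor H E →L[ℂ] HilbertTensor H F, HasSymbol T Φ := by
  choose g hg using hΦ
  let T : HilbertTensor H E →ₗ[ℂ] HilbertTensor H F :=
    { toFun := g
      map_add' x y := ext_evalTensor fun z : Ω => by simp only [map_add, hg]
      map_smul' c x := ext_evalTensor fun z : Ω => by
        simp only [map_smul, hg, RingHom.id_apply] }
  have hT : Continuous T := by
    refine LinearMap.continuous_of_seq_closed_graph T fun u x y hu hy => ?_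
    refine ext_evalTensor fun z : Ω => ?_
    have h1 : Tendsto (fun n => evalTensor H F z (T (u n))) atTop (𝓝 (evalTensor H F z y)) :=
      ((evalTensor H F z).continuous.tendsto y).comp hy
    have h2 : Tendsto (fun n => evalTensor H F z (T (u n))) atTop
        (𝓝 (Φ z (evalTensor H E z x))) := by
      have : (fun n => evalTensor H F z (T (u n))) = fun n => Φ z (evalTensor H E z (u n)) :=
        funext fun n => hg (u n) z
      rw [this]
      exact ((Φ z ∘L evalTensor H E z).continuous.tendsto x).comp hu
    rw [tendsto_nhds_unique h1 h2]
    exact (hg x z).symm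
  exact ⟨⟨T, hT⟩, fun z x => hg x z⟩

theorem HasSymbol.inner_adjoint {k : Ω → Ω → ℂ} (hk : IsSpaceOfKernel H k)
    {T : HilbertTensor H E →L[ℂ] HilbertTensor H F} {Φ : Ω → E →L[ℂ] F} (hT : HasSymbol T Φ)
    (z w : Ω) (e e' : F) :
    ⟪tmulL F (RKHS.kerFun H z 1) e, (T ∘L T.adjoint) (tmulL F (RKHS.kerFun H w 1) e')⟫_ℂ =
      k z w * ⟪(Φ z).adjoint e, (Φ w).adjoint e'⟫_ℂ := by
  rw [ContinuousLinearMap.comp_apply, ← ContinuousLinearMap.adjoint_inner_left,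
    hT.adjoint_tmulL, hT.adjoint_tmulL, inner_tmulL, hk.inner_kerFun]

/-- The values of a contractive multiplier are contractions. -/
theorem HasSymbol.norm_le_one {T : HilbertTensor H E →L[ℂ] HilbertTensor H F}
    {Φ : Ω → E →L[ℂ] F} (hT : HasSymbol T Φ) (hT1 : ‖T‖ ≤ 1) {w : Ω}
    (hw : RKHS.kerFun H w (1 : ℂ) ≠ 0) : ‖Φ w‖ ≤ 1 := by
  rw [← (ContinuousLinearMap.adjoint : (E →L[ℂ] F) ≃ₗᵢ⋆[ℂ] _).norm_map]
  refine ContinuousLinearMap.opNorm_le_bound _ zero_le_one fun e => ?_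
  have h1 : ‖T.adjoint‖ ≤ 1 := by
    rwa [(ContinuousLinearMap.adjoint : (HilbertTensor H E →L[ℂ] HilbertTensor H F)
      ≃ₗᵢ⋆[ℂ] _).norm_map]
  have h2 := T.adjoint.le_of_opNorm_le h1 (tmulL F (RKHS.kerFun H w 1) e)
  rw [hT.adjoint_tmulL, one_mul, norm_tmulL, norm_tmulL] at h2
  rw [one_mul]
  exact le_of_mul_le_mul_left h2 (norm_pos_iff.2 hw)

end Multiplier

/-! ### The Douglas property implies the complete Pick property. -/

section Necessity

variable {Ω H : Type*} [NormedAddCommGroup H] [InnerProductSpace ℂ H] [CompleteSpace H]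
  [RKHS ℂ H Ω ℂ]

/-- The Douglas property, applied to a pair of row multipliers `p`, `q` for which
`k (p p^* - q q^*) = 1`, yields a contractive multiplier `Γ` with `p Γ = q`. -/
theorem DouglasProperty.exists_contractive_symbol {k : Ω → Ω → ℂ} (hk : IsSpaceOfKernel H k)
    (hk0 : ∀ w, k w w ≠ 0) (hD : DouglasProperty (multiplierAlgebra H)) {p q : Ω → EllTwo →L[ℂ] ℂ}
    (hp : IsMultiplier H p) (hq : IsMultiplier H q)
    (hpq : ∀ z w, k z w * (⟪(p z).adjoint 1, (p w).adjoint 1⟫_ℂ -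
      ⟪(q z).adjoint 1, (q w).adjoint 1⟫_ℂ) = 1) :
    ∃ (C : HilbertTensor H EllTwo →L[ℂ] HilbertTensor H EllTwo) (Γ : Ω → EllTwo →L[ℂ] EllTwo),
      HasSymbol C Γ ∧ ‖C‖ ≤ 1 ∧ ∀ w, (Γ w).adjoint ((p w).adjoint 1) = (q w).adjoint 1 := by
  have hadj : ∀ (f : EllTwo →L[ℂ] ℂ) (c : ℂ), f.adjoint c = c • f.adjoint 1 := by
    intro f c
    rw [← map_smul, smul_eq_mul, mul_one]
  obtain ⟨Tp, hTp⟩ := hp.exists_hasSymbol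
  obtain ⟨Tq, hTq⟩ := hq.exists_hasSymbol
  -- Rows become operators on `H ⊗ ℓ²` by placing them in coordinate `0`.
  let J : ℂ →L[ℂ] EllTwo := ContinuousLinearMap.toSpanSingleton ℂ (basisVec 0)
  have hA : HasSymbol (ampliation H J ∘L Tp) fun z => J ∘L p z := fun z x => by
    rw [ContinuousLinearMap.comp_apply, evalTensor_ampliation, hTp,
      ContinuousLinearMap.comp_apply]
  have hB : HasSymbol (ampliation H J ∘L Tq) fun z => J ∘L q z := fun z x => by
    rw [ContinuousLinearMap.comp_apply, evalTensor_ampliation, hTq,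
      ContinuousLinearMap.comp_apply]
  obtain ⟨C, hC, hAC, hC1⟩ := hD _ hA.mem_wotTensor _ hB.mem_wotTensor (by
    rw [ContinuousLinearMap.le_def]
    refine isPositive_of_posSemidef _ (fun x : Ω × EllTwo => tmulL EllTwo (RKHS.kerFun H x.1 1) x.2)
      span_tmulL_kerFun ?_
    -- By `hpq`, the kernel factor cancels and only the Gram matrix of the scalars `J* e` remains.
    convert posSemidef_gramFamily (fun x : Ω × EllTwo => J.adjoint x.2) using 1
    ext x y
    rw [Matrix.of_apply, Matrix.gram_apply, sub_apply, inner_sub_right,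
      hA.inner_adjoint hk, hB.inner_adjoint hk]
    simp only [ContinuousLinearMap.adjoint_comp, ContinuousLinearMap.comp_apply]
    rw [hadj (p x.1), hadj (p y.1), hadj (q x.1), hadj (q y.1)]
    simp only [inner_smul_left, inner_smul_right, RCLike.inner_apply]
    linear_combination ((starRingEnd ℂ) (J.adjoint x.2) * J.adjoint y.2) * hpq x.1 y.1)
  obtain ⟨Γ, hΓ⟩ := exists_hasSymbol_of_mem_wotTensor
    (fun w : Ω => by rw [hk]; exact hk0 w) hC
  refine ⟨C, Γ, hΓ, hC1, fun w => ext_inner_right ℂ fun e => ?_⟩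
  rw [ContinuousLinearMap.adjoint_inner_left, ContinuousLinearMap.adjoint_inner_left,
    ContinuousLinearMap.adjoint_inner_left]
  have h1 := congr(⟪basisVec 0, evalTensor H EllTwo w
    ($hAC (tmulL EllTwo (RKHS.kerFun H w 1) e))⟫_ℂ)
  rw [ContinuousLinearMap.comp_apply, hA, hB, hΓ, evalTensor_tmulL_kerFun, hk] at h1
  simp only [map_smul, inner_smul_right, ContinuousLinearMap.comp_apply] at h1
  have h2 := mul_left_cancel₀ (hk0 w) h1
  have h3 : ⟪basisVec 0, basisVec 0⟫_ℂ = 1 := by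
    rw [inner_basisVec]
    simp [basisVec]
  simp only [J, ContinuousLinearMap.toSpanSingleton_apply, inner_smul_right, h3, mul_one] at h2
  rw [h2]

theorem isCompletePick_of_douglasProperty {k : Ω → Ω → ℂ} (hk : IsSpaceOfKernel H k)
    (hn : IsNice H k) (hD : DouglasProperty (multiplierAlgebra H)) : IsCompletePick k := by
  obtain ⟨-, p, q, hp, hq, hpq⟩ := hn
  have hk0 : ∀ z w, k z w ≠ 0 := by
    intro z w h0
    have := hpq z w
    rw [h0, zero_smul] at this
    exact one_ne_zero this
  have hPQ' : ∀ z w, k z w * (⟪(p z).adjoint 1, (p w).adjoint 1⟫_ℂ -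
      ⟪(q z).adjoint 1, (q w).adjoint 1⟫_ℂ) = 1 := by
    intro z w
    have h1 := congr($(hpq z w) (1 : ℂ))
    simp only [smul_apply, sub_apply, ContinuousLinearMap.comp_apply, smul_eq_mul] at h1
    rw [ContinuousLinearMap.adjoint_inner_left, ContinuousLinearMap.adjoint_inner_left]
    simpa using h1.symm
  obtain ⟨C, Γ, hΓ, hC1, hΓP'⟩ := hD.exists_contractive_symbol hk (fun w => hk0 w w) hp hq hPQ'
  obtain ⟨P, hP⟩ : ∃ P : Ω → EllTwo, ∀ w, P w = (p w).adjoint 1 := ⟨_, fun _ => rfl⟩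
  obtain ⟨Q, hQ⟩ : ∃ Q : Ω → EllTwo, ∀ w, Q w = (q w).adjoint 1 := ⟨_, fun _ => rfl⟩
  simp only [← hP, ← hQ] at hPQ' hΓP'
  refine ⟨hk.isKernel, fun ω => ?_⟩
  have hst : ∀ w, Γ ω (k ω w • Q w - k ω ω • Q ω) = k ω w • P w - k ω ω • P ω := by
    intro w
    have hy : ∀ z, C.adjoint (tmulL EllTwo (RKHS.kerFun H z 1) (P z)) =
        tmulL EllTwo (RKHS.kerFun H z 1) (Q z) := fun z => by rw [hΓ.adjoint_tmulL, hΓP']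
    -- All four terms `k (⟪P, P⟫ - ⟪Q, Q⟫)` equal `1`, so their signed sum `1 + 1 - 1 - 1` vanishes
    -- and `C*` is isometric on `v`.
    have h1 := apply_adjoint_eq_self hC1
      (v := tmulL EllTwo (RKHS.kerFun H w 1) (P w) - tmulL EllTwo (RKHS.kerFun H ω 1) (P ω)) (by
        simp only [map_sub, hy, inner_sub_left, inner_sub_right, inner_tmulL, hk.inner_kerFun]
        linear_combination hPQ' w w + hPQ' ω ω - hPQ' w ω - hPQ' ω w)
    have h2 := congrArg (evalTensor H EllTwo ω) h1
    rw [hΓ, map_sub C.adjoint, hy, hy, map_sub (evalTensor H EllTwo ω),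
      map_sub (evalTensor H EllTwo ω)] at h2
    simpa only [evalTensor_tmulL_kerFun, hk ω ω, hk w ω] using h2
  have hker : RKHS.kerFun H ω (1 : ℂ) ≠ 0 := by
    intro h
    apply hk0 ω ω
    rw [← hk.inner_kerFun, h, inner_zero_left]
  have hherm : ∀ z, (starRingEnd ℂ) (k ω z) = k z ω := by
    intro z
    rw [← hk.inner_kerFun, ← hk.inner_kerFun, inner_conj_symm]
  have hs : ∀ z w, k z w * (⟪k ω z • P z, k ω w • P w⟫_ℂ - ⟪k ω z • Q z, k ω w • Q w⟫_ℂ) =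
      k z ω * k ω w := by
    intro z w
    simp only [inner_smul_left, inner_smul_right, hherm]
    linear_combination k z ω * k ω w * hPQ' z w
  have hs1 : ∀ z, ⟪k ω z • P z, k ω ω • P ω⟫_ℂ - ⟪k ω z • Q z, k ω ω • Q ω⟫_ℂ = k ω ω :=
    fun z => mul_left_cancel₀ (hk0 z ω) (hs z ω)
  have hs2 : ∀ w, ⟪k ω ω • P ω, k ω w • P w⟫_ℂ - ⟪k ω ω • Q ω, k ω w • Q w⟫_ℂ = k ω ω :=
    fun w => mul_left_cancel₀ (hk0 ω w) ((hs ω w).trans (mul_comm _ _))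
  -- `L` is the defect of the contraction `Γ ω` on the vectors of `hst`.
  refine ⟨fun z w => ⟪k ω z • Q z - k ω ω • Q ω, k ω w • Q w - k ω ω • Q ω⟫_ℂ -
    ⟪Γ ω (k ω z • Q z - k ω ω • Q ω), Γ ω (k ω w • Q w - k ω ω • Q ω)⟫_ℂ,
    posSemidef_gram_sub_gram (hΓ.norm_le_one hC1 hker)
    fun z => k ω z • Q z - k ω ω • Q ω, fun z w => ?_⟩
  simp only [hst]
  rw [inner_sub_left, inner_sub_left, inner_sub_right, inner_sub_right, inner_sub_right,
    inner_sub_right]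
  linear_combination hs z w - k z w * hs1 z - k z w * hs2 w + k z w * hs1 ω

end Necessity

/-- The state equation of a contractive block operator is solved by a transfer function. -/
theorem exists_transferFunction {E K X : Type*}
    [NormedAddCommGroup E] [InnerProductSpace ℂ E] [NormedAddCommGroup K] [InnerProductSpace ℂ K]
    [NormedAddCommGroup X] [InnerProductSpace ℂ X] [CompleteSpace X]
    {V : WithLp 2 (E × HilbertTensor K X) →L[ℂ] WithLp 2 (E × X)}
    (hV : ‖V‖ ≤ 1) {β : K} (hβ : ‖β‖ < 1) :
    ∃ (Λ : E →L[ℂ] E) (R : E →L[ℂ] X),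
      (∀ e, V (WithLp.toLp 2 (e, tmulL X β (R e))) = WithLp.toLp 2 (Λ e, R e)) ∧
      ∀ e e' x, V (WithLp.toLp 2 (e, tmulL X β x)) = WithLp.toLp 2 (e', x) → Λ e = e' := by
  let U : E × HilbertTensor K X →L[ℂ] E × X :=
    (WithLp.prodContinuousLinearEquiv 2 ℂ E X : _ →L[ℂ] _) ∘L V ∘L
      ((WithLp.prodContinuousLinearEquiv 2 ℂ E (HilbertTensor K X)).symm : _ →L[ℂ] _)
  have hU : ∀ a b, V (WithLp.toLp 2 (a, b)) = WithLp.toLp 2 (U (a, b)) := fun a b => rfl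
  let U1 : E →L[ℂ] E × X := U ∘L ContinuousLinearMap.inl ℂ _ _
  let U2 : X →L[ℂ] E × X := U ∘L ContinuousLinearMap.inr ℂ _ _ ∘L tmulL X β
  have hU12 : ∀ e x, U (e, tmulL X β x) = U1 e + U2 x := by
    intro e x
    simp [U1, U2, ← map_add]
  -- The state equation for `x` is `x = (U1 e).2 + M x`; since `‖M‖ ≤ ‖β‖ < 1`, it has a unique
  -- solution `R e`.
  let M : X →L[ℂ] X := ContinuousLinearMap.snd ℂ _ _ ∘L U2
  have hM : ‖M‖ < 1 := by
    refine (ContinuousLinearMap.opNorm_le_bound _ (norm_nonneg β) fun x => ?_).trans_lt hβ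
    have h1 := V.le_of_opNorm_le hV (WithLp.toLp 2 (0, tmulL X β x))
    have h2 : ‖M x‖ ≤ ‖V (WithLp.toLp 2 (0, tmulL X β x))‖ := by
      have := WithLp.norm_snd_le (p := 2) (x := V (WithLp.toLp 2 (0, tmulL X β x)))
      exact this
    have h3 : ‖WithLp.toLp 2 ((0 : E), tmulL X β x)‖ = ‖β‖ * ‖x‖ := by
      simp [tmulL]
    rw [h3, one_mul] at h1
    exact h2.trans h1
  obtain ⟨N, hN⟩ := isUnit_one_sub_of_norm_lt_one hM
  let R : E →L[ℂ] X := (↑N⁻¹ : X →L[ℂ] X) ∘L ContinuousLinearMap.snd ℂ _ _ ∘L U1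
  have hR : ∀ e, R e = (U1 e).2 + M (R e) := by
    intro e
    have h1 : ((N : X →L[ℂ] X) * (↑N⁻¹ : X →L[ℂ] X)) (U1 e).2 = (U1 e).2 := by
      rw [Units.mul_inv, one_apply_eq_self]
    rw [mul_apply_eq_comp, hN, sub_apply, one_apply_eq_self, sub_eq_iff_eq_add] at h1
    exact h1
  have hRu : ∀ e x, x = (U1 e).2 + M x → x = R e := by
    intro e x hx
    have h1 : ((↑N⁻¹ : X →L[ℂ] X) * (N : X →L[ℂ] X)) x = x := by
      rw [Units.inv_mul, one_apply_eq_self]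
    have h2 : (1 - M) x = (U1 e).2 := by
      rw [sub_apply, one_apply_eq_self, sub_eq_iff_eq_add]
      exact hx
    rw [mul_apply_eq_comp, hN, h2] at h1
    exact h1.symm
  refine ⟨ContinuousLinearMap.fst ℂ _ _ ∘L (U1 + U2 ∘L R), R, fun e => ?_, fun e e' x hx => ?_⟩
  · rw [hU, hU12]
    congr 1
    exact Prod.ext rfl (hR e).symm
  · rw [hU, hU12] at hx
    have hx' : U1 e + U2 x = (e', x) := congrArg WithLp.ofLp hx
    have h1 : x = R e := hRu e x (congrArg Prod.snd hx').symm
    have h2 := congrArg Prod.fst hx'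
    rw [h1] at h2
    exact h2

/-! ### Leech's theorem by a lurking isometry. -/

section Leech

variable {Ω H E K : Type*} [NormedAddCommGroup H] [InnerProductSpace ℂ H] [CompleteSpace H]
  [RKHS ℂ H Ω ℂ] [NormedAddCommGroup E] [InnerProductSpace ℂ E] [CompleteSpace E]
  [NormedAddCommGroup K] [InnerProductSpace ℂ K]

/-- Leech's theorem for a kernel with a complete Pick factorization: an operator inequality between
multiplication operators is solved by a contractive multiplier. -/
theorem exists_contractive_multiplier {β : Ω → K} {γ : Ω → ℂ} (hγ : ∀ w, γ w ≠ 0)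
    (hβγ : ∀ z w, ⟪RKHS.kerFun H z (1 : ℂ), RKHS.kerFun H w (1 : ℂ)⟫_ℂ * (1 - ⟪β z, β w⟫_ℂ) =
      (starRingEnd ℂ) (γ z) * γ w)
    {A B : HilbertTensor H E →L[ℂ] HilbertTensor H E} {Φ Ψ : Ω → E →L[ℂ] E}
    (hA : HasSymbol A Φ) (hB : HasSymbol B Ψ) (hAB : B ∘L B.adjoint ≤ A ∘L A.adjoint) :
    ∃ (C : HilbertTensor H E →L[ℂ] HilbertTensor H E) (Γ : Ω → E →L[ℂ] E),
      HasSymbol C Γ ∧ A ∘L C = B ∧ ‖C‖ ≤ 1 := by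
  let k : Ω → Ω → ℂ := fun z w => ⟪RKHS.kerFun H z (1 : ℂ), RKHS.kerFun H w (1 : ℂ)⟫_ℂ
  have hk : IsSpaceOfKernel H k := fun w z => by simp only [k]; rw [RKHS.kerFun_inner]; simp
  obtain ⟨S, hS⟩ := CStarAlgebra.nonneg_iff_eq_star_mul_self.1 (sub_nonneg.2 hAB)
  -- Dividing by `γ` turns the factor `k` in `AA* - BB* = S*S` into `1 / (1 - ⟪β z, β w⟫)`.
  let G : Ω → E → HilbertTensor H E := fun w e => (γ w)⁻¹ • S (tmulL E (RKHS.kerFun H w 1) e)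
  have hG : ∀ z w e e', (1 - ⟪β z, β w⟫_ℂ) * ⟪G z e, G w e'⟫_ℂ =
      ⟪(Φ z).adjoint e, (Φ w).adjoint e'⟫_ℂ - ⟪(Ψ z).adjoint e, (Ψ w).adjoint e'⟫_ℂ := by
    intro z w e e'
    have h1 : ⟪S (tmulL E (RKHS.kerFun H z 1) e), S (tmulL E (RKHS.kerFun H w 1) e')⟫_ℂ =
        k z w * (⟪(Φ z).adjoint e, (Φ w).adjoint e'⟫_ℂ -
          ⟪(Ψ z).adjoint e, (Ψ w).adjoint e'⟫_ℂ) := by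
      rw [← ContinuousLinearMap.adjoint_inner_right, ← ContinuousLinearMap.star_eq_adjoint,
        ← mul_apply_eq_comp, ← hS, sub_apply, inner_sub_right, hA.inner_adjoint hk,
        hB.inner_adjoint hk, mul_sub]
    have hz : (starRingEnd ℂ) (γ z) ≠ 0 := (map_ne_zero _).2 (hγ z)
    have hw := hγ w
    simp only [G, inner_smul_left, inner_smul_right, h1, map_inv₀]
    have h2 := hβγ z w
    change k z w * _ = _ at h2
    field_simp
    linear_combination (⟪(Φ z).adjoint e, (Φ w).adjoint e'⟫_ℂ -
          ⟪(Ψ z).adjoint e, (Ψ w).adjoint e'⟫_ℂ) * h2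
  have hβ1 : ∀ w, ‖β w‖ < 1 := by
    intro w
    have h1 := hβγ w w
    rw [inner_self_eq_norm_sq_to_K, inner_self_eq_norm_sq_to_K, ← Complex.normSq_eq_conj_mul_self]
      at h1
    have h2 : ‖RKHS.kerFun H w (1 : ℂ)‖ ^ 2 * (1 - ‖β w‖ ^ 2) = Complex.normSq (γ w) := by
      apply Complex.ofReal_injective
      push_cast
      exact h1
    have h3 : 0 < 1 - ‖β w‖ ^ 2 := by
      refine pos_of_mul_pos_right ?_ (sq_nonneg ‖RKHS.kerFun H w (1 : ℂ)‖)
      rw [h2]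
      exact Complex.normSq_pos.2 (hγ w)
    exact (sq_lt_one_iff₀ (norm_nonneg _)).1 (by linarith)
  -- Rearranged so that both sides are sums, `hG` says that the two families have equal Gram
  -- matrices.
  obtain ⟨V, hV, hVab⟩ := exists_contraction_of_gram_le
    (fun x : Ω × E => (WithLp.toLp 2 ((Φ x.1).adjoint x.2,
      tmulL (HilbertTensor H E) (β x.1) (G x.1 x.2)) :
        WithLp 2 (E × HilbertTensor K (HilbertTensor H E))))
    (fun x : Ω × E => (WithLp.toLp 2 ((Ψ x.1).adjoint x.2, G x.1 x.2) :
      WithLp 2 (E × HilbertTensor H E))) (by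
    convert Matrix.PosSemidef.zero using 1
    ext x y
    simp only [Matrix.sub_apply, Matrix.gram_apply, WithLp.prod_inner_apply, inner_tmulL,
      Matrix.zero_apply]
    linear_combination -hG x.1 y.1 x.2 y.2)
  choose Λ R hΛR hΛu using fun w => exists_transferFunction hV (hβ1 w)
  have hΛ : ∀ w e, Λ w ((Φ w).adjoint e) = (Ψ w).adjoint e := fun w e =>
    hΛu w _ _ _ (hVab (w, e))
  obtain ⟨T, hT1, hT⟩ := exists_contraction_of_gram_le
    (fun x : Ω × E => tmulL E (RKHS.kerFun H x.1 1) x.2)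
    (fun x : Ω × E => tmulL E (RKHS.kerFun H x.1 1) (Λ x.1 x.2)) (by
    -- With `V (e, β ⊗ R e) = (Λ e, R e)`, the kernel `k (⟪e, e'⟫ - ⟪Λ e, Λ e'⟫)` is `k` times the
    -- defect of `V` plus `k (1 - ⟪β, β⟫) ⟪R e, R e'⟫`. The first is positive by the Schur product
    -- theorem, the second is the Gram matrix of `γ • R e`.
    refine Eq.mpr (congrArg Matrix.PosSemidef (Matrix.ext fun x y => ?_))
      (((posSemidef_gramFamily (fun x : Ω × E => RKHS.kerFun H x.1 (1 : ℂ))).hadamard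
        (posSemidef_gram_sub_gram hV (fun x : Ω × E => (WithLp.toLp 2 (x.2,
          tmulL (HilbertTensor H E) (β x.1) (R x.1 x.2)) :
            WithLp 2 (E × HilbertTensor K (HilbertTensor H E)))))).add
        (posSemidef_gramFamily (fun x : Ω × E => γ x.1 • R x.1 x.2)))
    simp only [Matrix.sub_apply, Matrix.gram_apply, WithLp.prod_inner_apply, inner_tmulL,
      Matrix.add_apply, Matrix.hadamard_apply, hΛR, inner_smul_left, inner_smul_right]
    linear_combination ⟪R x.1 x.2, R y.1 y.2⟫_ℂ * hβγ x.1 y.1)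
  have hC : HasSymbol T.adjoint fun w => (Λ w).adjoint := by
    intro w x
    refine ext_inner_left ℂ fun e => ?_
    rw [← inner_tmulL_kerFun, ContinuousLinearMap.adjoint_inner_right,
      ContinuousLinearMap.adjoint_inner_right, hT (w, e), inner_tmulL_kerFun]
  refine ⟨T.adjoint, fun w => (Λ w).adjoint, hC, ?_, ?_⟩
  · ext1 x
    refine ext_evalTensor fun w : Ω => ext_inner_left ℂ fun e => ?_
    rw [ContinuousLinearMap.comp_apply, hA, hC, hB, ← ContinuousLinearMap.adjoint_inner_left,
      ContinuousLinearMap.adjoint_inner_right, hΛ, ContinuousLinearMap.adjoint_inner_left]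
  · rwa [(ContinuousLinearMap.adjoint : (HilbertTensor H E →L[ℂ] HilbertTensor H E)
      ≃ₗᵢ⋆[ℂ] _).norm_map]

end Leech

/-! ### The complete Pick property implies the Douglas property. -/

section Sufficiency

variable {Ω H : Type*} [NormedAddCommGroup H] [InnerProductSpace ℂ H] [CompleteSpace H]
  [RKHS ℂ H Ω ℂ]

theorem douglasProperty_of_isCompletePick {k : Ω → Ω → ℂ} (hk : IsSpaceOfKernel H k)
    (hk0 : ∀ z w, k z w ≠ 0) (hP : IsCompletePick k) :
    DouglasProperty (multiplierAlgebra H) := by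
  intro A hA B hB hAB
  have hkw : ∀ w : Ω, RKHS.kerFun H w (1 : ℂ) w ≠ 0 := fun w => by rw [hk]; exact hk0 w w
  obtain ⟨Φ, hΦ⟩ := exists_hasSymbol_of_mem_wotTensor hkw hA
  obtain ⟨Ψ, hΨ⟩ := exists_hasSymbol_of_mem_wotTensor hkw hB
  obtain hΩ | ⟨⟨ω⟩⟩ := isEmpty_or_nonempty Ω
  · refine ⟨0, HasSymbol.mem_wotTensor (Φ := fun _ => 0) fun z => hΩ.elim z, ?_,
      ContinuousLinearMap.opNorm_zero.trans_le zero_le_one⟩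
    ext1 x
    exact ext_evalTensor fun z : Ω => hΩ.elim z
  obtain ⟨L, hL, hLk⟩ := hP.2 ω
  obtain ⟨K, _, _, _, β, hβ⟩ := exists_gram_eq hL
  set r : ℝ := ‖RKHS.kerFun H ω (1 : ℂ)‖ with hr
  have hr2 : (r : ℂ) ^ 2 = k ω ω := by
    rw [← hk.inner_kerFun, inner_self_eq_norm_sq_to_K]
    rfl
  have hr0 : (r : ℂ) ≠ 0 := fun h => hk0 ω ω (by rw [← hr2, h]; simp)
  -- Dividing the Pick identity at `ω` by `k(ω,ω) = r²` gives the required factorization.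
  obtain ⟨C, Γ, hC, h⟩ := exists_contractive_multiplier (β := fun w => (r : ℂ)⁻¹ • β w)
    (γ := fun w => (r : ℂ)⁻¹ * k ω w) (fun w => mul_ne_zero (inv_ne_zero hr0) (hk0 ω w))
    (fun z w => by
      have hherm : (starRingEnd ℂ) (k ω z) = k z ω := by
        rw [← hk.inner_kerFun, ← hk.inner_kerFun, inner_conj_symm]
      rw [hk.inner_kerFun, inner_smul_left, inner_smul_right, hβ, map_mul, hherm, map_inv₀,
        Complex.conj_ofReal]
      have := hLk z w
      rw [← hr2] at this
      field_simp
      linear_combination this) hΦ hΨ hAB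
  exact ⟨C, hC.mem_wotTensor, h⟩

end Sufficiency

end DouglasPick

theorem theorem1p7 {Ω H : Type*} [NormedAddCommGroup H] [InnerProductSpace ℂ H] [CompleteSpace H]
    [RKHS ℂ H Ω ℂ] (k : Ω → Ω → ℂ) (hk : DouglasPick.IsSpaceOfKernel H k) :
    (DouglasPick.IsNice H k → DouglasPick.DouglasProperty (DouglasPick.multiplierAlgebra H) →
      DouglasPick.IsCompletePick k) ∧
    ((∀ z w : Ω, k z w ≠ 0) → DouglasPick.IsCompletePick k →
      DouglasPick.DouglasProperty (DouglasPick.multiplierAlgebra H)) :=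
  ⟨DouglasPick.isCompletePick_of_douglasProperty hk,
    DouglasPick.douglasProperty_of_isCompletePick hk⟩
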